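/- For $f:\{0,1\}^n\to\mathbb R$ write $\|f\|_2=(\mathbb E_x[f(x)^2])^{1/2}$ and $\hat f(S)=\mathbb E_x[f(x)(-1)^{\sum_{i\in S}x_i}]$ for $S\subseteq[n]$, where $x$ is uniform on $\{0,1\}^n$; the Fourier degree of $f$ is the largest $|S|$ with $\hat f(S)\ne0$ (and $0$ if $f=0$), and $f$ is a $k$-junta if it depends on at most $k$ of its variables. The function $f$ is XOS if $f(x)=\max_{w\in C}\sum_{i=1}^n w_ix_i$ for all $x$, for some nonempty finite set $C$ of vectors $w\in\mathbb R_{\ge0}^n$. (1) There is an absolute constant $K>0$ such that for every $n$, every XOS function $f:\{0,1\}^n\to[0,1]$ and every $\varepsilon>0$ there is a function $p:\{0,1\}^n\to\mathbb R$ that is a $k$-junta for some $k\le 2^{K/\varepsilon}$, has Fourier degree at most $K/\varepsilon$, and satisfies $\|f-p\|_2\le\varepsilon$ and $\sum_{S\subseteq[n]}|\hat p(S)|\le 2^{K/\varepsilon^2}$. (2) The junta size in (1) is optimal up to the constant in the exponent: there are absolute constants $c,\varepsilon_0>0$ such that for every $\varepsilon\in(0,\varepsilon_0]$ there are an $n$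 and an XOS function $f:\{0,1\}^n\to[0,1]$ such that every $k$-junta $g:\{0,1\}^n\to\mathbb R$ with $\|f-g\|_2\le\varepsilon$ has $k\ge 2^{c/\varepsilon}$. -/

import Mathlib

open scoped BigOperators

noncomputable section

namespace BoolCube

/-- The real number `0` or `1` corresponding to a bit. -/
def bit (b : Bool) : ℝ := if b then 1 else 0

/-- The function `f` on `{0,1}^n` is XOS: it is the maximum of a nonempty finite family of
linear functions `x ↦ ∑ i, w i * x i` with nonnegative weights. -/
def IsXOS {n : ℕ} (f : (Fin n → Bool) → ℝ) : Prop :=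
  ∃ (C : Finset (Fin n → ℝ)) (hC : C.Nonempty),
    (∀ w ∈ C, ∀ i, 0 ≤ w i) ∧ ∀ x, f x = C.sup' hC (fun w => ∑ i, w i * bit (x i))

/-- The `ℓ₂`-norm with respect to the uniform distribution on `{0,1}^n`. -/
def l2Norm {n : ℕ} (f : (Fin n → Bool) → ℝ) : ℝ :=
  Real.sqrt (𝔼 x, f x ^ 2)

/-- The parity function `χ_S(x) = (-1)^{∑_{i ∈ S} x_i}`. -/
def parity {n : ℕ} (S : Finset (Fin n)) (x : Fin n → Bool) : ℝ :=
  (-1) ^ (∑ i ∈ S, (x i).toNat)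

/-- The Fourier coefficient `E_x[f(x) χ_S(x)]`, for `x` uniform on `{0,1}^n`. -/
def fourierHat {n : ℕ} (f : (Fin n → Bool) → ℝ) (S : Finset (Fin n)) : ℝ :=
  𝔼 x, f x * parity S x

open Classical in
/-- The Fourier degree: the largest `|S|` with nonzero coefficient at `S`
(`0` for the zero function). -/
def fourierDegree {n : ℕ} (f : (Fin n → Bool) → ℝ) : ℕ :=
  (Finset.univ.filter (fun S : Finset (Fin n) => fourierHat f S ≠ 0)).sup Finset.card

/-- The spectral `ℓ₁`-norm. -/
def spectralNorm1 {n : ℕ} (f : (Fin n → Bool) → ℝ) : ℝ :=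
  ∑ S : Finset (Fin n), |fourierHat f S|

/-- The function `f` is a `k`-junta: it depends on at most `k` of the coordinates. -/
def IsJunta {n : ℕ} (k : ℕ) (f : (Fin n → Bool) → ℝ) : Prop :=
  ∃ J : Finset (Fin n), J.card ≤ k ∧ DependsOn f (J : Set (Fin n))

end BoolCube

end

/-! Part (1). A linear function attaining the maximum at `z` supplies weights `W z` of total at most
`1` that bound how much `f` drops when bits of `z` change. So the one-bit drops at a point sum to at
most `1`, which bounds the total `ℓ₁`-influence. The one-bit gains can have a huge sum at single
points, but `decr_mul_decr_le` bounds their products on average, so the second moment of their sum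
is at most `3` (`expect_sq_sum_decr_flip_le`). Hence `∑ |S|² f̂(S)² ≤ 1`, and the Fourier weight
above level `d` is at most `1/(d+1)²`. This square is what permits degree `O(1/ε)`; total influence
alone would give `O(1/ε²)`. Below level `d`, hypercontractivity (`sq_sum_fourierHat_sq_le`) makes
the weight on sets meeting non-influential coordinates negligible. Keeping the small sets of
influential coordinates gives `p`.

Part (2). `maxBlock` is the largest fraction of ones among `2^b` blocks of `b + 1` bits. With
probability bounded away from `0` and `1` some block is full, and this moves the value from at most
`1 - 1/(b+1)` to `1`. A junta touching fewer than half of the blocks cannot predict the event, so it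
errs by order `1/b`. -/

namespace BoolCube

open Finset

variable {n : ℕ}

/-! ### Fourier analysis on the cube. -/

/-- Flip the `i`-th bit of `x`. -/
def flip (i : Fin n) (x : Fin n → Bool) : Fin n → Bool := Function.update x i (!x i)

@[simp] lemma flip_same (i : Fin n) (x : Fin n → Bool) : flip i x i = !x i := by simp [flip]

lemma flip_of_ne {i j : Fin n} (h : j ≠ i) (x : Fin n → Bool) : flip i x j = x j := by
  simp [flip, h]

@[simp] lemma flip_flip (i : Fin n) (x : Fin n → Bool) : flip i (flip i x) = x := by
  simp [flip]

lemma flip_comm (i j : Fin n) (x : Fin n → Bool) : flip i (flip j x) = flip j (flip i x) := by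
  by_cases h : i = j
  · rw [h]
  · funext k
    by_cases hi : k = i
    · subst hi; simp [flip_of_ne h]
    · by_cases hj : k = j
      · subst hj; simp [flip_of_ne hi]
      · simp [flip_of_ne hi, flip_of_ne hj]

/-- Flipping a bit as a permutation of the cube. -/
def flipEquiv (i : Fin n) : (Fin n → Bool) ≃ (Fin n → Bool) :=
  ⟨flip i, flip i, flip_flip i, flip_flip i⟩

lemma expect_flip (i : Fin n) (φ : (Fin n → Bool) → ℝ) : 𝔼 x, φ (flip i x) = 𝔼 x, φ x :=
  Fintype.expect_equiv (flipEquiv i) _ _ fun _ => rfl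

lemma expect_eq_zero_of_flip_neg (i : Fin n) (φ : (Fin n → Bool) → ℝ)
    (h : ∀ x, φ (flip i x) = -φ x) : 𝔼 x, φ x = 0 := by
  have h1 := expect_flip i φ
  simp only [h, expect_neg_distrib] at h1
  linarith

/-- The sign `(-1)^b` of a bit. -/
noncomputable def sgn (b : Bool) : ℝ := (-1) ^ b.toNat

lemma sgn_not (b : Bool) : sgn (!b) = -sgn b := by cases b <;> simp [sgn]

lemma sgn_mul_self (b : Bool) : sgn b * sgn b = 1 := by cases b <;> simp [sgn]

lemma parity_eq_prod (S : Finset (Fin n)) (x : Fin n → Bool) :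
    parity S x = ∏ i ∈ S, sgn (x i) := by
  simp [parity, sgn, Finset.prod_pow_eq_pow_sum]

lemma parity_mul_self (S : Finset (Fin n)) (x : Fin n → Bool) :
    parity S x * parity S x = 1 := by
  rw [parity_eq_prod, ← Finset.prod_mul_distrib]
  exact Finset.prod_eq_one fun i _ => sgn_mul_self _

lemma abs_parity (S : Finset (Fin n)) (x : Fin n → Bool) : |parity S x| = 1 := by
  simp [parity]

lemma parity_flip_of_mem {i : Fin n} {S : Finset (Fin n)} (h : i ∈ S) (x : Fin n → Bool) :
    parity S (flip i x) = -parity S x := by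
  rw [parity_eq_prod, parity_eq_prod, ← Finset.mul_prod_erase _ _ h, ← Finset.mul_prod_erase _ _ h,
    flip_same, sgn_not, neg_mul]
  congr 2
  exact Finset.prod_congr rfl fun j hj => by rw [flip_of_ne (Finset.ne_of_mem_erase hj)]

lemma parity_flip_of_notMem {i : Fin n} {S : Finset (Fin n)} (h : i ∉ S) (x : Fin n → Bool) :
    parity S (flip i x) = parity S x := by
  rw [parity_eq_prod, parity_eq_prod]
  exact Finset.prod_congr rfl fun j hj => by rw [flip_of_ne (ne_of_mem_of_not_mem hj h)]

lemma parity_insert {i : Fin n} {S : Finset (Fin n)} (h : i ∉ S) (x : Fin n → Bool) :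
    parity (insert i S) x = sgn (x i) * parity S x := by
  rw [parity_eq_prod, parity_eq_prod, Finset.prod_insert h]

lemma expect_parity_mul_parity (S T : Finset (Fin n)) :
    𝔼 x, parity S x * parity T x = if S = T then 1 else 0 := by
  split_ifs with h
  · subst h
    simp [parity_mul_self]
  · obtain ⟨i, hi⟩ : ∃ i, ¬ (i ∈ S ↔ i ∈ T) := by
      by_contra! hc
      exact h (Finset.ext hc)
    refine expect_eq_zero_of_flip_neg i _ fun x => ?_
    by_cases hS : i ∈ S
    · have hT : i ∉ T := by tauto
      rw [parity_flip_of_mem hS, parity_flip_of_notMem hT, neg_mul]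
    · have hT : i ∈ T := by tauto
      rw [parity_flip_of_notMem hS, parity_flip_of_mem hT, mul_neg]

/-- The sum over `S` expands `∏ i, (1 + sgn (x i) * sgn (y i))`, which has a zero factor wherever
`x` and `y` differ. -/
lemma sum_parity_mul_parity (x y : Fin n → Bool) :
    ∑ S : Finset (Fin n), parity S x * parity S y = if y = x then 2 ^ n else 0 := by
  have h : ∑ S : Finset (Fin n), parity S x * parity S y
      = ∏ i : Fin n, (1 + sgn (x i) * sgn (y i)) := by
    rw [Finset.prod_one_add, Finset.powerset_univ]
    exact Finset.sum_congr rfl fun S _ => by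
      rw [parity_eq_prod, parity_eq_prod, Finset.prod_mul_distrib]
  rw [h]
  split_ifs with hxy
  · subst hxy
    simp only [sgn_mul_self]
    norm_num
  · obtain ⟨i, hi⟩ := Function.ne_iff.1 hxy
    refine Finset.prod_eq_zero (Finset.mem_univ i) ?_
    revert hi
    cases x i <;> cases y i <;> simp [sgn]

/-- Fourier inversion. -/
lemma sum_fourierHat_mul_parity (f : (Fin n → Bool) → ℝ) (x : Fin n → Bool) :
    ∑ S, fourierHat f S * parity S x = f x := by
  simp only [fourierHat, Finset.expect_mul]
  rw [← Finset.expect_sum_comm]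
  have : ∀ y, ∑ S, f y * parity S y * parity S x = if y = x then f x * 2 ^ n else 0 := by
    intro y
    simp only [mul_assoc, ← Finset.mul_sum, sum_parity_mul_parity]
    by_cases h : y = x
    · simp [h]
    · simp [h, Ne.symm h]
  simp only [this, Fintype.expect_eq_sum_div_card]
  simp

lemma expect_mul_eq_sum_fourierHat (f g : (Fin n → Bool) → ℝ) :
    𝔼 x, f x * g x = ∑ S, fourierHat f S * fourierHat g S := by
  have : ∀ x, f x * g x = ∑ S, fourierHat f S * (g x * parity S x) := by
    intro x
    rw [← sum_fourierHat_mul_parity f x, Finset.sum_mul]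
    exact Finset.sum_congr rfl fun S _ => by ring
  simp only [this]
  rw [Finset.expect_sum_comm]
  exact Finset.sum_congr rfl fun S _ => by rw [← Finset.mul_expect]; rfl

/-- Parseval's identity. -/
lemma expect_sq_eq_sum_fourierHat (f : (Fin n → Bool) → ℝ) :
    𝔼 x, f x ^ 2 = ∑ S, fourierHat f S ^ 2 := by
  simpa only [sq] using expect_mul_eq_sum_fourierHat f f

/-- The function with prescribed Fourier coefficients `a S` for `S ∈ 𝒜`. -/
noncomputable def fourierSum (𝒜 : Finset (Finset (Fin n))) (a : Finset (Fin n) → ℝ)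
    (x : Fin n → Bool) : ℝ :=
  ∑ S ∈ 𝒜, a S * parity S x

lemma fourierHat_fourierSum (𝒜 : Finset (Finset (Fin n))) (a : Finset (Fin n) → ℝ)
    (T : Finset (Fin n)) : fourierHat (fourierSum 𝒜 a) T = if T ∈ 𝒜 then a T else 0 := by
  simp only [fourierHat, fourierSum, Finset.sum_mul]
  rw [Finset.expect_sum_comm]
  simp only [mul_assoc, ← Finset.mul_expect, expect_parity_mul_parity]
  simp

lemma fourierHat_sub (f g : (Fin n → Bool) → ℝ) (S : Finset (Fin n)) :
    fourierHat (f - g) S = fourierHat f S - fourierHat g S := by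
  simp [fourierHat, sub_mul, Finset.expect_sub_distrib]

/-- The `i`-th Laplacian `x ↦ (f x - f (flip i x)) / 2`. -/
noncomputable def lap (i : Fin n) (f : (Fin n → Bool) → ℝ) (x : Fin n → Bool) : ℝ :=
  (f x - f (flip i x)) / 2

lemma fourierHat_lap (i : Fin n) (f : (Fin n → Bool) → ℝ) (S : Finset (Fin n)) :
    fourierHat (lap i f) S = if i ∈ S then fourierHat f S else 0 := by
  have h2 : 𝔼 x, f (flip i x) * parity S (flip i x) = fourierHat f S :=
    expect_flip i fun x => f x * parity S x
  have h1 : fourierHat (lap i f) S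
      = (𝔼 x, f x * parity S x - 𝔼 x, f (flip i x) * parity S x) / 2 := by
    rw [← Finset.expect_sub_distrib, Finset.expect_div]
    exact Finset.expect_congr rfl fun x _ => by simp only [lap]; ring
  rw [h1]
  change (fourierHat f S - _) / 2 = _
  split_ifs with hi
  · simp only [parity_flip_of_mem hi, mul_neg, Finset.expect_neg_distrib] at h2
    linarith
  · simp only [parity_flip_of_notMem hi] at h2
    linarith

/-- Each `lap i` keeps exactly the coefficients of the sets containing `i`, so their sum multiplies
the coefficient at `S` by `S.card`; Parseval does the rest. -/
lemma sum_card_sq_mul_fourierHat_sq (f : (Fin n → Bool) → ℝ) :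
    ∑ S, (S.card : ℝ) ^ 2 * fourierHat f S ^ 2 = 𝔼 x, (∑ i, lap i f x) ^ 2 := by
  rw [expect_sq_eq_sum_fourierHat]
  refine Finset.sum_congr rfl fun S _ => ?_
  have : fourierHat (fun x => ∑ i, lap i f x) S = ∑ i, fourierHat (lap i f) S := by
    simp only [fourierHat, Finset.sum_mul]
    rw [Finset.expect_sum_comm]
  rw [this]
  simp [fourierHat_lap, mul_pow]

/-! ### Hypercontractivity and the low-level weight inequality. -/

/-- Bonami's hypercontractive inequality between `ℓ₂` and `ℓ₄`. -/
lemma expect_fourierSum_pow_four_le (T : Finset (Fin n)) (a : Finset (Fin n) → ℝ) :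
    𝔼 x, fourierSum T.powerset a x ^ 4 ≤ (∑ S ∈ T.powerset, 3 ^ S.card * a S ^ 2) ^ 2 := by
  induction T using Finset.induction_on generalizing a with
  | empty => simp [fourierSum, parity]; ring_nf; rfl
  | insert i T hi ih =>
    set g := fourierSum T.powerset a with hg
    set h := fourierSum T.powerset (fun S => a (insert i S)) with hh
    set A := ∑ S ∈ T.powerset, 3 ^ S.card * a S ^ 2 with hA
    set B := ∑ S ∈ T.powerset, 3 ^ S.card * a (insert i S) ^ 2 with hB
    have hA0 : 0 ≤ A := Finset.sum_nonneg fun S _ => by positivity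
    have hB0 : 0 ≤ B := Finset.sum_nonneg fun S _ => by positivity
    have inv : ∀ (b : Finset (Fin n) → ℝ) x,
        fourierSum T.powerset b (flip i x) = fourierSum T.powerset b x := fun b x =>
      Finset.sum_congr rfl fun S hS => by
        rw [parity_flip_of_notMem fun hiS => hi (Finset.mem_powerset.1 hS hiS)]
    have hf : ∀ x, fourierSum (insert i T).powerset a x = g x + sgn (x i) * h x := by
      intro x
      simp only [fourierSum, hg, hh]
      rw [Finset.sum_powerset_insert hi, Finset.mul_sum]
      congr 1
      refine Finset.sum_congr rfl fun S hS => ?_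
      rw [parity_insert fun hiS => hi (Finset.mem_powerset.1 hS hiS)]
      ring
    have hR : ∑ S ∈ (insert i T).powerset, 3 ^ S.card * a S ^ 2 = A + 3 * B := by
      rw [Finset.sum_powerset_insert hi, Finset.mul_sum]
      congr 1
      refine Finset.sum_congr rfl fun S hS => ?_
      rw [Finset.card_insert_of_notMem fun hiS => hi (Finset.mem_powerset.1 hS hiS)]
      ring
    -- As `g` and `h` ignore bit `i`, the odd terms of `(g + sgn * h)^4` average out. What is left
    -- is at most `A² + 6AB + B² ≤ (A + 3B)²`.
    have hodd : 𝔼 x, sgn (x i) * (4 * (g x ^ 3 * h x) + 4 * (g x * h x ^ 3)) = 0 :=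
      expect_eq_zero_of_flip_neg i _ fun x => by
        rw [flip_same, sgn_not, hg, hh, inv, inv, neg_mul]
    have hexp : 𝔼 x, fourierSum (insert i T).powerset a x ^ 4
        = 𝔼 x, g x ^ 4 + 6 * 𝔼 x, g x ^ 2 * h x ^ 2 + 𝔼 x, h x ^ 4 := by
      rw [Finset.mul_expect, ← Finset.expect_add_distrib, ← Finset.expect_add_distrib,
        ← add_zero (𝔼 x, (_ + _)), ← hodd, ← Finset.expect_add_distrib]
      refine Finset.expect_congr rfl fun x _ => ?_
      have hs : sgn (x i) ^ 2 = 1 := by rw [sq, sgn_mul_self]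
      rw [hf]
      linear_combination (6 * g x ^ 2 * h x ^ 2 + 4 * sgn (x i) * g x * h x ^ 3
        + (sgn (x i) ^ 2 + 1) * h x ^ 4) * hs
    have hcs := Finset.expect_mul_sq_le_sq_mul_sq univ (fun x => g x ^ 2) (fun x => h x ^ 2)
    simp only [← pow_mul] at hcs
    have hgA : 𝔼 x, g x ^ 4 ≤ A ^ 2 := ih a
    have hhB : 𝔼 x, h x ^ 4 ≤ B ^ 2 := ih _
    have hh0 : 0 ≤ 𝔼 x, h x ^ 4 := Finset.expect_nonneg fun x _ => by positivity
    have hmid : 𝔼 x, g x ^ 2 * h x ^ 2 ≤ A * B := by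
      refine (sq_le_sq₀ (Finset.expect_nonneg fun x _ => by positivity) (by positivity)).1 ?_
      calc _ ≤ (𝔼 x, g x ^ 4) * 𝔼 x, h x ^ 4 := hcs
        _ ≤ A ^ 2 * B ^ 2 := mul_le_mul hgA hhB hh0 (by positivity)
        _ = _ := by ring
    rw [hexp, hR]
    nlinarith [mul_nonneg hB0 hB0]

/-- The `ℓ₂`-weight that `g` with values in `[-1, 1]` has on levels at most `d` is small if the
`ℓ₁`-norm of `g` is small. -/
lemma sq_sum_fourierHat_sq_le (g : (Fin n → Bool) → ℝ) (hg : ∀ x, |g x| ≤ 1) (d : ℕ)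
    (𝒜 : Finset (Finset (Fin n))) (h𝒜 : ∀ S ∈ 𝒜, S.card ≤ d) :
    (∑ S ∈ 𝒜, fourierHat g S ^ 2) ^ 2 ≤ 9 ^ d * (𝔼 x, |g x|) ^ 3 := by
  set t := ∑ S ∈ 𝒜, fourierHat g S ^ 2 with ht
  set h := fourierSum 𝒜 (fourierHat g) with hh
  set a := 𝔼 x, |g x| with ha
  have ht0 : 0 ≤ t := Finset.sum_nonneg fun S _ => by positivity
  have ha0 : 0 ≤ a := Finset.expect_nonneg fun x _ => abs_nonneg _
  have htgh : t = 𝔼 x, g x * h x := by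
    rw [expect_mul_eq_sum_fourierHat, hh]
    simp only [fourierHat_fourierSum, mul_ite, mul_zero, ← sq]
    rw [Finset.sum_ite_mem, Finset.univ_inter]
  have h4 : 𝔼 x, h x ^ 4 ≤ 9 ^ d * t ^ 2 := by
    have e : h = fourierSum univ.powerset (fun S => if S ∈ 𝒜 then fourierHat g S else 0) := by
      funext x
      simp [hh, fourierSum]
    rw [e]
    refine (expect_fourierSum_pow_four_le _ _).trans ?_
    have : ∑ S ∈ (univ : Finset (Fin n)).powerset,
        3 ^ S.card * (if S ∈ 𝒜 then fourierHat g S else 0) ^ 2 ≤ 3 ^ d * t := by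
      simp only [ite_pow, mul_ite, Finset.powerset_univ]
      norm_num
      rw [ht, Finset.mul_sum]
      refine Finset.sum_le_sum fun S hS => ?_
      exact mul_le_mul_of_nonneg_right (pow_le_pow_right₀ (by norm_num) (h𝒜 S hS)) (sq_nonneg _)
    calc _ ≤ (3 ^ d * t) ^ 2 := by
          refine pow_le_pow_left₀ (Finset.sum_nonneg fun S _ => by positivity) this 2
      _ = _ := by rw [mul_pow, ← pow_mul, mul_comm d, pow_mul]; norm_num
  -- Two applications of Cauchy–Schwarz to `t = 𝔼 g h`, the second using `g² ≤ |g|`, give `t^4 ≤ a^3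
  -- * 𝔼 h^4 ≤ a^3 * 9^d * t^2`; then `t^2` cancels unless `t = 0`.
  have e1 : t ^ 2 ≤ a * 𝔼 x, |g x| * h x ^ 2 := by
    have := Finset.expect_mul_sq_le_sq_mul_sq univ (fun x => √|g x|) (fun x => √|g x| * |h x|)
    simp only [mul_pow, Real.sq_sqrt (abs_nonneg _), sq_abs, ← mul_assoc,
      Real.mul_self_sqrt (abs_nonneg _)] at this
    refine le_trans ?_ this
    refine pow_le_pow_left₀ ht0 ?_ 2
    rw [htgh]
    refine Finset.expect_le_expect fun x _ => ?_
    rw [← abs_mul]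
    exact le_abs_self _
  have e2 : (𝔼 x, |g x| * h x ^ 2) ^ 2 ≤ a * 𝔼 x, h x ^ 4 := by
    refine (Finset.expect_mul_sq_le_sq_mul_sq univ (fun x => |g x|) (fun x => h x ^ 2)).trans ?_
    norm_num only [← pow_mul]
    refine mul_le_mul_of_nonneg_right ?_ (Finset.expect_nonneg fun x _ => by positivity)
    refine Finset.expect_le_expect fun x _ => ?_
    nlinarith [hg x, abs_nonneg (g x)]
  have e3 : t ^ 2 * t ^ 2 ≤ t ^ 2 * (9 ^ d * a ^ 3) := by
    calc t ^ 2 * t ^ 2 = (t ^ 2) ^ 2 := by ring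
      _ ≤ (a * 𝔼 x, |g x| * h x ^ 2) ^ 2 := pow_le_pow_left₀ (by positivity) e1 2
      _ = a ^ 2 * (𝔼 x, |g x| * h x ^ 2) ^ 2 := by ring
      _ ≤ a ^ 2 * (a * (9 ^ d * t ^ 2)) := by gcongr; exact e2.trans (by gcongr)
      _ = _ := by ring
  rcases ht0.eq_or_lt with h0 | h0
  · rw [← h0, zero_pow two_ne_zero]; positivity
  · exact le_of_mul_le_mul_left e3 (by positivity)

/-! ### Supporting weights of XOS functions and the moment bounds they imply. -/

/-- A family of nonnegative weights supporting `f`: at every point `z` the total weight is at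
most `1`, and changing the bits in `T` decreases `f` by at most the weight of `T`. -/
structure Weights (f : (Fin n → Bool) → ℝ) (W : (Fin n → Bool) → Fin n → ℝ) : Prop where
  nonneg : ∀ z i, 0 ≤ W z i
  sum_le : ∀ z, ∑ i, W z i ≤ 1
  sub_le : ∀ z y (T : Finset (Fin n)), (∀ i ∉ T, y i = z i) → f z - f y ≤ ∑ i ∈ T, W z i

/-- For a vector `w` attaining the maximum at `z`, the weights `w i * bit (z i)` sum to `f z`, and
the same `w` bounds `f y` from below at every other point. -/
lemma IsXOS.exists_weights {f : (Fin n → Bool) → ℝ} (hf : IsXOS f) (h1 : ∀ x, f x ≤ 1) :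
    ∃ W, Weights f W := by
  obtain ⟨C, hC, hnn, hfC⟩ := hf
  have : ∀ z, ∃ w ∈ C, f z = ∑ i, w i * bit (z i) := fun z => by
    rw [hfC]
    exact Finset.exists_mem_eq_sup' hC _
  choose w hw hfw using this
  have hb : ∀ b, 0 ≤ bit b := fun b => by cases b <;> simp [bit]
  refine ⟨fun z i => w z i * bit (z i), fun z i => mul_nonneg (hnn _ (hw z) i) (hb _),
    fun z => (hfw z).symm.trans_le (h1 z), fun z y T hT => ?_⟩
  have hy : ∑ i, w z i * bit (y i) ≤ f y := by
    rw [hfC y]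
    exact Finset.le_sup' (fun w => ∑ i, w i * bit (y i)) (hw z)
  calc f z - f y ≤ ∑ i, (w z i * bit (z i) - w z i * bit (y i)) := by
        rw [Finset.sum_sub_distrib, ← hfw]; linarith
    _ = ∑ i ∈ T, (w z i * bit (z i) - w z i * bit (y i)) := by
        refine (Finset.sum_subset (Finset.subset_univ T) fun i _ hi => ?_).symm
        rw [hT i hi, sub_self]
    _ ≤ _ := Finset.sum_le_sum fun i _ =>
        sub_le_self _ (mul_nonneg (hnn _ (hw z) i) (hb _))

lemma IsXOS.monotone {f : (Fin n → Bool) → ℝ} (hf : IsXOS f) : Monotone f := by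
  obtain ⟨C, hC, hnn, hfC⟩ := hf
  intro x y hxy
  rw [hfC, hfC]
  refine Finset.sup'_mono_fun fun w hw => Finset.sum_le_sum fun i _ => ?_
  refine mul_le_mul_of_nonneg_left ?_ (hnn w hw i)
  have := hxy i
  revert this
  cases x i <;> cases y i <;> simp [bit]

/-- The decrease of `f` at `x` when the `i`-th bit is erased. -/
noncomputable def decr (f : (Fin n → Bool) → ℝ) (i : Fin n) (x : Fin n → Bool) : ℝ :=
  if x i then f x - f (flip i x) else 0

lemma flip_le {i : Fin n} {x : Fin n → Bool} (h : x i = true) : flip i x ≤ x := by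
  intro j
  by_cases hj : j = i
  · subst hj; simp [h]
  · rw [flip_of_ne hj]

lemma decr_nonneg {f : (Fin n → Bool) → ℝ} (hf : Monotone f) (i : Fin n) (x : Fin n → Bool) :
    0 ≤ decr f i x := by
  unfold decr
  split_ifs with h
  · exact sub_nonneg.2 (hf (flip_le h))
  · exact le_rfl

lemma two_mul_lap (f : (Fin n → Bool) → ℝ) (i : Fin n) (x : Fin n → Bool) :
    2 * lap i f x = decr f i x - decr f i (flip i x) := by
  unfold lap decr
  cases h : x i <;> simp [h] <;> ring

lemma abs_lap_le (f : (Fin n → Bool) → ℝ) (hf : Monotone f) (i : Fin n) (x : Fin n → Bool) :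
    2 * |lap i f x| ≤ decr f i x + decr f i (flip i x) := by
  have h1 := decr_nonneg hf i x
  have h2 := decr_nonneg hf i (flip i x)
  have h3 := two_mul_lap f i x
  rw [← abs_two, ← abs_mul, h3, abs_le]
  constructor <;> linarith

namespace Weights

variable {f : (Fin n → Bool) → ℝ} {W : (Fin n → Bool) → Fin n → ℝ}

lemma le_one (h : Weights f W) (z : Fin n → Bool) (i : Fin n) : W z i ≤ 1 :=
  (Finset.single_le_sum (fun j _ => h.nonneg z j) (Finset.mem_univ i)).trans (h.sum_le z)

lemma decr_le (h : Weights f W) (i : Fin n) (z : Fin n → Bool) : decr f i z ≤ W z i := by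
  unfold decr
  split_ifs
  · refine (h.sub_le z (flip i z) {i} fun j hj => flip_of_ne (by simpa using hj) z).trans ?_
    simp
  · exact h.nonneg z i

lemma sum_decr_le (h : Weights f W) (z : Fin n → Bool) : ∑ i, decr f i z ≤ 1 :=
  (Finset.sum_le_sum fun i _ => h.decr_le i z).trans (h.sum_le z)

/-- A factor vanishes unless both bits of `z` are `1`. In that case each factor is at most the loss
from erasing both bits, hence at most `W z i + W z j`. Bounding the larger factor this way yields `p
* q ≤ W z i * q + W z j * p`, and the one-bit bounds at the flipped points finish. Each product on
the right sums to at most `1` over all `i`, `j`. -/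
lemma decr_mul_decr_le (h : Weights f W) (hf : Monotone f) {i j : Fin n} (hij : i ≠ j)
    (z : Fin n → Bool) :
    decr f i (flip j z) * decr f j (flip i z)
      ≤ W z i * W (flip i z) j + W z j * W (flip j z) i := by
  set p := decr f i (flip j z) with hp
  set q := decr f j (flip i z) with hq
  have hp0 : 0 ≤ p := decr_nonneg hf _ _
  have hq0 : 0 ≤ q := decr_nonneg hf _ _
  have hpW : p ≤ W (flip j z) i := h.decr_le _ _
  have hqW : q ≤ W (flip i z) j := h.decr_le _ _
  have hi := h.nonneg z i
  have hj := h.nonneg z j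
  by_cases hzi : z i = true
  swap
  · have : p = 0 := by simp [hp, decr, flip_of_ne hij, hzi]
    rw [this, zero_mul]
    exact add_nonneg (mul_nonneg hi (h.nonneg _ _)) (mul_nonneg hj (h.nonneg _ _))
  by_cases hzj : z j = true
  swap
  · have : q = 0 := by simp [hq, decr, flip_of_ne hij.symm, hzj]
    rw [this, mul_zero]
    exact add_nonneg (mul_nonneg hi (h.nonneg _ _)) (mul_nonneg hj (h.nonneg _ _))
  have hm : f z - f (flip i (flip j z)) ≤ W z i + W z j := by
    refine (h.sub_le z _ {i, j} fun k hk => ?_).trans (Finset.sum_pair hij).le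
    simp only [Finset.mem_insert, Finset.mem_singleton, not_or] at hk
    rw [flip_of_ne hk.1, flip_of_ne hk.2]
  have hpm : p ≤ W z i + W z j := by
    simp only [hp, decr, flip_of_ne hij, hzi, if_true]
    linarith [hf (flip_le hzj)]
  have hqm : q ≤ W z i + W z j := by
    simp only [hq, decr, flip_of_ne hij.symm, hzj, if_true]
    rw [flip_comm]
    linarith [hf (flip_le hzi)]
  have key : p * q ≤ W z i * q + W z j * p := by
    rcases le_total p q with hle | hle <;> nlinarith
  nlinarith

/-- The second moment of the total increase of an XOS function is bounded. -/
lemma expect_sq_sum_decr_flip_le (h : Weights f W) (hf : Monotone f) :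
    𝔼 x, (∑ i, decr f i (flip i x)) ^ 2 ≤ 3 := by
  have hterm : ∀ i j, 𝔼 x, decr f i (flip i x) * decr f j (flip j x)
      ≤ 𝔼 z, ((if i = j then W z i else 0)
        + (W z i * W (flip i z) j + W z j * W (flip j z) i)) := by
    intro i j
    have hWW : ∀ z k l y, 0 ≤ W z k * W y l := fun z k l y =>
      mul_nonneg (h.nonneg _ _) (h.nonneg _ _)
    by_cases hij : i = j
    · subst hij
      rw [expect_flip i fun x => decr f i x * decr f i x]
      refine Finset.expect_le_expect fun z _ => ?_
      rw [if_pos rfl]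
      have h1 := h.decr_le i z
      have h2 := decr_nonneg hf i z
      have h3 := h.le_one z i
      nlinarith [hWW z i i (flip i z)]
    -- Substituting for `x` the point `z` with bits `i` and `j` flipped turns two gains at `x` into
    -- drops at `flip j z` and `flip i z`.
    · rw [← expect_flip i, ← expect_flip j]
      refine Finset.expect_le_expect fun z _ => ?_
      rw [if_neg hij, zero_add, flip_flip, flip_comm i j, flip_flip]
      exact h.decr_mul_decr_le hf hij z
  have hpt : ∀ z, ∑ i, ∑ j, ((if i = j then W z i else 0)
      + (W z i * W (flip i z) j + W z j * W (flip j z) i)) ≤ 3 := by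
    intro z
    have h1 : ∑ i, ∑ j, W z i * W (flip i z) j ≤ 1 := by
      refine le_trans (Finset.sum_le_sum fun i _ => ?_) (h.sum_le z)
      rw [← Finset.mul_sum]
      exact mul_le_of_le_one_right (h.nonneg _ _) (h.sum_le _)
    have h2 : ∑ i, ∑ j, W z j * W (flip j z) i ≤ 1 := by
      rw [Finset.sum_comm]; exact h1
    have h3 := h.sum_le z
    simp only [Finset.sum_add_distrib, Finset.sum_ite_eq, Finset.mem_univ, if_true]
    linarith
  calc 𝔼 x, (∑ i, decr f i (flip i x)) ^ 2
      = ∑ i, ∑ j, 𝔼 x, decr f i (flip i x) * decr f j (flip j x) := by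
        simp only [sq, Finset.sum_mul_sum, Finset.expect_sum_comm]
    _ ≤ _ := Finset.sum_le_sum fun i _ => Finset.sum_le_sum fun j _ => hterm i j
    _ = 𝔼 z, ∑ i, ∑ j, ((if i = j then W z i else 0)
          + (W z i * W (flip i z) j + W z j * W (flip j z) i)) := by
        simp only [Finset.expect_sum_comm]
    _ ≤ 3 := Finset.expect_le Finset.univ_nonempty fun z _ => hpt z

/-- The Laplacian of an XOS function is bounded in `ℓ₂`. -/
lemma sum_card_sq_mul_fourierHat_sq_le (h : Weights f W) (hf : Monotone f) :
    ∑ S, (S.card : ℝ) ^ 2 * fourierHat f S ^ 2 ≤ 1 := by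
  rw [sum_card_sq_mul_fourierHat_sq]
  -- The Laplacian is half of total drop minus total gain; both are nonnegative and the drop is at
  -- most `1`. On average the bound becomes `(1 + 3) / 4`.
  have hpt : ∀ x, (∑ i, lap i f x) ^ 2 ≤ (1 + (∑ i, decr f i (flip i x)) ^ 2) / 4 := by
    intro x
    have e : 2 * ∑ i, lap i f x = ∑ i, decr f i x - ∑ i, decr f i (flip i x) := by
      rw [Finset.mul_sum, ← Finset.sum_sub_distrib]
      exact Finset.sum_congr rfl fun i _ => two_mul_lap f i x
    have hu0 : 0 ≤ ∑ i, decr f i x := Finset.sum_nonneg fun i _ => decr_nonneg hf i x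
    have hv0 : 0 ≤ ∑ i, decr f i (flip i x) := Finset.sum_nonneg fun i _ => decr_nonneg hf i _
    have hu1 := h.sum_decr_le x
    have e2 : ∑ i, lap i f x = (∑ i, decr f i x - ∑ i, decr f i (flip i x)) / 2 := by linarith
    rw [e2]
    nlinarith [mul_nonneg hu0 hv0]
  have h3 := h.expect_sq_sum_decr_flip_le hf
  calc _ ≤ 𝔼 x, (1 + (∑ i, decr f i (flip i x)) ^ 2) / 4 :=
        Finset.expect_le_expect fun x _ => hpt x
    _ = (1 + 𝔼 x, (∑ i, decr f i (flip i x)) ^ 2) / 4 := by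
        rw [← Finset.expect_div, Finset.expect_add_distrib, Fintype.expect_const]
    _ ≤ 1 := by linarith

lemma abs_lap_le_one (h : Weights f W) (hf : Monotone f) (i : Fin n) (x : Fin n → Bool) :
    |lap i f x| ≤ 1 := by
  linarith [abs_lap_le f hf i x, h.decr_le i x, h.decr_le i (flip i x), h.le_one x i,
    h.le_one (flip i x) i]

/-- The total `ℓ₁`-influence of an XOS function is bounded. -/
lemma sum_expect_abs_lap_le (h : Weights f W) (hf : Monotone f) :
    ∑ i, 𝔼 x, |lap i f x| ≤ 1 := by
  calc ∑ i, 𝔼 x, |lap i f x| ≤ ∑ i, 𝔼 x, decr f i x := by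
        refine Finset.sum_le_sum fun i _ => ?_
        have h1 : 𝔼 x, 2 * |lap i f x| ≤ 𝔼 x, (decr f i x + decr f i (flip i x)) :=
          Finset.expect_le_expect fun x _ => abs_lap_le f hf i x
        rw [← Finset.mul_expect, Finset.expect_add_distrib, expect_flip i (decr f i)] at h1
        linarith
    _ = 𝔼 x, ∑ i, decr f i x := (Finset.expect_sum_comm _ _ _).symm
    _ ≤ 1 := Finset.expect_le Finset.univ_nonempty fun x _ => h.sum_decr_le x

end Weights

/-! ### Truncating the Fourier expansion to small sets of influential coordinates. -/

/-- The subsets of `J` of cardinality at most `d`. -/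
def smallSubsets (J : Finset (Fin n)) (d : ℕ) : Finset (Finset (Fin n)) :=
  J.powerset.filter fun S => S.card ≤ d

lemma mem_smallSubsets {J : Finset (Fin n)} {d : ℕ} {S : Finset (Fin n)} :
    S ∈ smallSubsets J d ↔ S ⊆ J ∧ S.card ≤ d := by simp [smallSubsets]

/-- A set of size at most `d + 1` arises from one of size at most `d` by inserting an element of
`J`, or nothing (`none`): `J.card + 1` choices each time. -/
lemma card_smallSubsets_le (J : Finset (Fin n)) (d : ℕ) :
    (smallSubsets J d).card ≤ (J.card + 1) ^ d := by
  induction d with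
  | zero =>
    rw [pow_zero, Finset.card_le_one]
    intro S hS T hT
    simp only [mem_smallSubsets, Nat.le_zero, Finset.card_eq_zero] at hS hT
    rw [hS.2, hT.2]
  | succ d ih =>
    have hsub : smallSubsets J (d + 1) ⊆ (Finset.insertNone J ×ˢ smallSubsets J d).image
        fun q => q.1.elim q.2 fun i => insert i q.2 := by
      intro S hS
      rw [mem_smallSubsets] at hS
      rw [Finset.mem_image]
      rcases S.eq_empty_or_nonempty with rfl | ⟨i, hi⟩
      · exact ⟨(none, ∅), by simp [mem_smallSubsets], rfl⟩
      · refine ⟨(some i, S.erase i), ?_, Finset.insert_erase hi⟩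
        rw [Finset.mem_product, mem_smallSubsets, Finset.some_mem_insertNone,
          Finset.card_erase_of_mem hi]
        exact ⟨hS.1 hi, (Finset.erase_subset _ _).trans hS.1, by omega⟩
    calc _ ≤ _ := Finset.card_le_card hsub
      _ ≤ _ := Finset.card_image_le
      _ = (J.card + 1) * (smallSubsets J d).card := by
        rw [Finset.card_product, Finset.card_insertNone]
      _ ≤ _ := by rw [pow_succ']; gcongr

lemma dependsOn_fourierSum {J : Finset (Fin n)} {𝒜 : Finset (Finset (Fin n))}
    (h : ∀ S ∈ 𝒜, S ⊆ J) (a : Finset (Fin n) → ℝ) :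
    DependsOn (fourierSum 𝒜 a) (J : Set (Fin n)) := by
  intro x y hxy
  refine Finset.sum_congr rfl fun S hS => ?_
  rw [parity_eq_prod, parity_eq_prod]
  congr 1
  exact Finset.prod_congr rfl fun i hi => by rw [hxy i (h S hS hi)]

lemma fourierDegree_fourierSum_le {d : ℕ} {𝒜 : Finset (Finset (Fin n))}
    (h : ∀ S ∈ 𝒜, S.card ≤ d) (a : Finset (Fin n) → ℝ) :
    fourierDegree (fourierSum 𝒜 a) ≤ d := by
  refine Finset.sup_le fun S hS => h S ?_
  by_contra hc
  simp [fourierHat_fourierSum, hc] at hS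

lemma abs_fourierHat_le_one {f : (Fin n → Bool) → ℝ} (hf : ∀ x, |f x| ≤ 1)
    (S : Finset (Fin n)) : |fourierHat f S| ≤ 1 := by
  refine (Finset.abs_expect_le _ _).trans (Finset.expect_le Finset.univ_nonempty fun x _ => ?_)
  rw [abs_mul, abs_parity, mul_one]
  exact hf x

lemma spectralNorm1_fourierSum_le {f : (Fin n → Bool) → ℝ} (hf : ∀ x, |f x| ≤ 1)
    (𝒜 : Finset (Finset (Fin n))) :
    spectralNorm1 (fourierSum 𝒜 (fourierHat f)) ≤ 𝒜.card := by
  have : spectralNorm1 (fourierSum 𝒜 (fourierHat f)) = ∑ S ∈ 𝒜, |fourierHat f S| := by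
    simp [spectralNorm1, fourierHat_fourierSum, apply_ite]
  rw [this, ← nsmul_one 𝒜.card]
  exact Finset.sum_le_card_nsmul _ _ _ fun S _ => abs_fourierHat_le_one hf S

lemma expect_sq_sub_fourierSum (f : (Fin n → Bool) → ℝ) (𝒜 : Finset (Finset (Fin n))) :
    𝔼 x, (f - fourierSum 𝒜 (fourierHat f)) x ^ 2 = ∑ S ∈ 𝒜ᶜ, fourierHat f S ^ 2 := by
  rw [expect_sq_eq_sum_fourierHat, ← Finset.sum_compl_add_sum 𝒜]
  have h1 : ∀ S ∈ 𝒜ᶜ, fourierHat (f - fourierSum 𝒜 (fourierHat f)) S ^ 2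
      = fourierHat f S ^ 2 := fun S hS => by
    rw [fourierHat_sub, fourierHat_fourierSum, if_neg (Finset.mem_compl.1 hS), sub_zero]
  have h2 : ∀ S ∈ 𝒜, fourierHat (f - fourierSum 𝒜 (fourierHat f)) S ^ 2 = 0 := fun S hS => by
    rw [fourierHat_sub, fourierHat_fourierSum, if_pos hS, sub_self, zero_pow two_ne_zero]
  rw [Finset.sum_congr rfl h1, Finset.sum_congr rfl h2, Finset.sum_const_zero, add_zero]

lemma sum_biUnion_le_sum {ι κ : Type*} [DecidableEq ι] [DecidableEq κ] (s : Finset ι)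
    (t : ι → Finset κ) {φ : κ → ℝ} (hφ : ∀ a, 0 ≤ φ a) :
    ∑ a ∈ s.biUnion t, φ a ≤ ∑ i ∈ s, ∑ a ∈ t i, φ a := by
  induction s using Finset.induction_on with
  | empty => simp
  | insert i s hi ih =>
    rw [Finset.biUnion_insert, Finset.sum_insert hi]
    have h := Finset.sum_union_inter (s₁ := t i) (s₂ := s.biUnion t) (f := φ)
    have h0 : 0 ≤ ∑ a ∈ t i ∩ s.biUnion t, φ a := Finset.sum_nonneg fun a _ => hφ a
    linarith

/-- The coordinates whose `ℓ₁`-influence on `f` exceeds `τ`. -/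
noncomputable def influential (f : (Fin n → Bool) → ℝ) (τ : ℝ) : Finset (Fin n) :=
  open Classical in Finset.univ.filter fun i => τ < 𝔼 x, |lap i f x|

lemma mem_influential {f : (Fin n → Bool) → ℝ} {τ : ℝ} {i : Fin n} :
    i ∈ influential f τ ↔ τ < 𝔼 x, |lap i f x| := by simp [influential]

namespace Weights

variable {f : (Fin n → Bool) → ℝ} {W : (Fin n → Bool) → Fin n → ℝ}

lemma card_influential_mul_le (h : Weights f W) (hf : Monotone f) (τ : ℝ) :
    (influential f τ).card * τ ≤ 1 := by
  rw [← nsmul_eq_mul]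
  calc _ ≤ ∑ i ∈ influential f τ, 𝔼 x, |lap i f x| :=
        Finset.card_nsmul_le_sum _ _ _ fun i hi => (mem_influential.1 hi).le
    _ ≤ ∑ i, 𝔼 x, |lap i f x| :=
        Finset.sum_le_sum_of_subset_of_nonneg (Finset.subset_univ _) fun i _ _ =>
          Finset.expect_nonneg fun x _ => abs_nonneg _
    _ ≤ 1 := h.sum_expect_abs_lap_le hf

/-- The weight on the high levels. -/
lemma sum_high_le (h : Weights f W) (hf : Monotone f) (d : ℕ) :
    ((d : ℝ) + 1) ^ 2 * ∑ S with d < S.card, fourierHat f S ^ 2 ≤ 1 := by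
  rw [Finset.mul_sum]
  calc _ ≤ ∑ S with d < S.card, (S.card : ℝ) ^ 2 * fourierHat f S ^ 2 := by
        refine Finset.sum_le_sum fun S hS => ?_
        have hd : ((d + 1 : ℕ) : ℝ) ≤ S.card := Nat.cast_le.2 (Finset.mem_filter.1 hS).2
        push_cast at hd
        gcongr
    _ ≤ ∑ S, (S.card : ℝ) ^ 2 * fourierHat f S ^ 2 :=
        Finset.sum_le_sum_of_subset_of_nonneg (Finset.subset_univ _) fun S _ _ => by positivity
    _ ≤ 1 := h.sum_card_sq_mul_fourierHat_sq_le hf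

/-- The weight that the low levels have outside the influential coordinates. -/
lemma sum_low_le (h : Weights f W) (hf : Monotone f) (d : ℕ) {ρ : ℝ} (hρ : 0 ≤ ρ) :
    ∑ S with S.card ≤ d ∧ ¬ S ⊆ influential f (ρ ^ 2), fourierHat f S ^ 2 ≤ 3 ^ d * ρ := by
  have hsub : (univ.filter fun S : Finset (Fin n) => S.card ≤ d ∧ ¬ S ⊆ influential f (ρ ^ 2))
      ⊆ (influential f (ρ ^ 2))ᶜ.biUnion fun i => univ.filter fun S => i ∈ S ∧ S.card ≤ d := by
    intro S hS
    obtain ⟨hd, hJ⟩ := (Finset.mem_filter.1 hS).2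
    obtain ⟨i, hiS, hiJ⟩ := Finset.not_subset.1 hJ
    simp only [Finset.mem_biUnion, Finset.mem_compl, Finset.mem_filter, Finset.mem_univ, true_and]
    exact ⟨i, hiJ, hiS, hd⟩
  have hone : ∀ i ∈ (influential f (ρ ^ 2))ᶜ,
      ∑ S with i ∈ S ∧ S.card ≤ d, fourierHat f S ^ 2 ≤ 3 ^ d * ρ * 𝔼 x, |lap i f x| := by
    intro i hi
    rw [Finset.mem_compl, mem_influential, not_lt] at hi
    have ha0 : 0 ≤ 𝔼 x, |lap i f x| := Finset.expect_nonneg fun x _ => abs_nonneg _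
    -- One factor of the cubed influence is at most `ρ ^ 2`. The remaining square leaves a bound
    -- linear in the influence after taking roots, so the sum over `i` is controlled by the total
    -- influence.
    have key := sq_sum_fourierHat_sq_le (lap i f) (h.abs_lap_le_one hf i) d
      (univ.filter fun S => i ∈ S ∧ S.card ≤ d) fun S hS => (Finset.mem_filter.1 hS).2.2
    have e : ∑ S with i ∈ S ∧ S.card ≤ d, fourierHat (lap i f) S ^ 2
        = ∑ S with i ∈ S ∧ S.card ≤ d, fourierHat f S ^ 2 :=
      Finset.sum_congr rfl fun S hS => by
        rw [fourierHat_lap, if_pos (Finset.mem_filter.1 hS).2.1]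
    rw [e] at key
    refine (sq_le_sq₀ (Finset.sum_nonneg fun S _ => sq_nonneg _) (by positivity)).1 ?_
    refine key.trans ?_
    have h9 : ((3 : ℝ) ^ d) ^ 2 = 9 ^ d := by rw [← pow_mul, mul_comm, pow_mul]; norm_num
    calc 9 ^ d * (𝔼 x, |lap i f x|) ^ 3
        = 9 ^ d * ((𝔼 x, |lap i f x|) * (𝔼 x, |lap i f x|) ^ 2) := by ring
      _ ≤ 9 ^ d * (ρ ^ 2 * (𝔼 x, |lap i f x|) ^ 2) := by gcongr
      _ = (3 ^ d * ρ * 𝔼 x, |lap i f x|) ^ 2 := by rw [← h9]; ring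
  calc _ ≤ _ := Finset.sum_le_sum_of_subset_of_nonneg hsub fun S _ _ => sq_nonneg _
    _ ≤ ∑ i ∈ (influential f (ρ ^ 2))ᶜ, ∑ S with i ∈ S ∧ S.card ≤ d, fourierHat f S ^ 2 :=
        sum_biUnion_le_sum _ _ fun S => sq_nonneg _
    _ ≤ ∑ i ∈ (influential f (ρ ^ 2))ᶜ, 3 ^ d * ρ * 𝔼 x, |lap i f x| := Finset.sum_le_sum hone
    _ ≤ ∑ i, 3 ^ d * ρ * 𝔼 x, |lap i f x| :=
        Finset.sum_le_sum_of_subset_of_nonneg (Finset.subset_univ _) fun i _ _ =>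
          mul_nonneg (by positivity) (Finset.expect_nonneg fun x _ => abs_nonneg _)
    _ ≤ 3 ^ d * ρ := by
        rw [← Finset.mul_sum]
        exact mul_le_of_le_one_right (by positivity) (h.sum_expect_abs_lap_le hf)

lemma expect_sq_sub_le (h : Weights f W) (hf : Monotone f) (d : ℕ) {ρ : ℝ} (hρ : 0 ≤ ρ) :
    𝔼 x, (f - fourierSum (smallSubsets (influential f (ρ ^ 2)) d) (fourierHat f)) x ^ 2
      ≤ 1 / ((d : ℝ) + 1) ^ 2 + 3 ^ d * ρ := by
  rw [expect_sq_sub_fourierSum]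
  have hsub : (smallSubsets (influential f (ρ ^ 2)) d)ᶜ ⊆ (univ.filter fun S => d < S.card)
      ∪ univ.filter fun S => S.card ≤ d ∧ ¬ S ⊆ influential f (ρ ^ 2) := by
    intro S hS
    simp only [Finset.mem_compl, mem_smallSubsets] at hS
    simp only [Finset.mem_union, Finset.mem_filter, Finset.mem_univ, true_and]
    rcases lt_or_ge d S.card with h | h
    · exact Or.inl h
    · exact Or.inr ⟨h, fun h' => hS ⟨h', h⟩⟩
  have hdis : Disjoint (univ.filter fun S : Finset (Fin n) => d < S.card)
      (univ.filter fun S => S.card ≤ d ∧ ¬ S ⊆ influential f (ρ ^ 2)) :=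
    Finset.disjoint_filter.2 fun S _ h1 h2 => by omega
  refine (Finset.sum_le_sum_of_subset_of_nonneg hsub fun S _ _ => sq_nonneg _).trans ?_
  rw [Finset.sum_union hdis]
  refine add_le_add ?_ (h.sum_low_le hf d hρ)
  rw [le_div_iff₀ (by positivity), mul_comm]
  exact h.sum_high_le hf d

end Weights

/-! ### Choice of parameters for the junta theorem. -/

/-- The size of the junta in terms of the accuracy. -/
lemma le_two_rpow_of_mul_le {ε m : ℝ} (h0 : 0 < ε) (h1 : ε < 1) {d : ℕ} (hd : (d : ℝ) ≤ 3 / ε)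
    (hm : m * (ε ^ 2 / (2 * 3 ^ d)) ^ 2 ≤ 1) : m + 1 ≤ (2 : ℝ) ^ (19 / ε) := by
  have hε : 1 ≤ 1 / ε := (one_le_div h0).2 h1.le
  have hinv : 1 / ε ≤ (2 : ℝ) ^ (1 / ε) := by
    have := one_add_mul_self_le_rpow_one_add (s := 1) (by norm_num) hε
    norm_num at this ⊢
    linarith
  have hm' : m ≤ 4 * 9 ^ d * (1 / ε) ^ 4 := by
    have e : (ε ^ 2 / (2 * 3 ^ d)) ^ 2 = 1 / (4 * 9 ^ d * (1 / ε) ^ 4) := by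
      have h9 : ((3 : ℝ) ^ d) ^ 2 = 9 ^ d := by rw [← pow_mul, mul_comm, pow_mul]; norm_num
      rw [div_pow, mul_pow, h9]
      field_simp
      norm_num
    rw [e, mul_one_div, div_le_one (by positivity)] at hm
    exact hm
  have h9 : (9 : ℝ) ^ d ≤ 2 ^ (12 / ε) := by
    calc (9 : ℝ) ^ d ≤ 16 ^ d := pow_le_pow_left₀ (by norm_num) (by norm_num) d
      _ = (2 : ℝ) ^ (4 * (d : ℝ)) := by
        rw [Real.rpow_mul (by norm_num), Real.rpow_natCast]; norm_num
      _ ≤ _ := by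
        refine Real.rpow_le_rpow_of_exponent_le (by norm_num) ?_
        calc 4 * (d : ℝ) ≤ 4 * (3 / ε) := by linarith
          _ = _ := by ring
  have h4 : (4 : ℝ) ≤ 2 ^ (2 / ε) := by
    calc (4 : ℝ) = 2 ^ (2 : ℝ) := by norm_num
      _ ≤ _ := Real.rpow_le_rpow_of_exponent_le (by norm_num) (by
        rw [div_eq_mul_one_div]; linarith)
  -- The exponent is `18 = 2 + 12 + 4`, from `4`, `9 ^ d` and `(1 / ε) ^ 4`; one more `1 / ε`
  -- absorbs the added `1`.
  have hm2 : m ≤ 2 ^ (18 / ε) := by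
    calc m ≤ 4 * 9 ^ d * (1 / ε) ^ 4 := hm'
      _ ≤ 2 ^ (2 / ε) * 2 ^ (12 / ε) * ((2 : ℝ) ^ (1 / ε)) ^ 4 := by gcongr
      _ = _ := by
        rw [← Real.rpow_natCast, ← Real.rpow_mul (by norm_num), ← Real.rpow_add (by norm_num),
          ← Real.rpow_add (by norm_num)]
        congr 1
        push_cast
        ring
  have h18 : (1 : ℝ) ≤ 2 ^ (18 / ε) := Real.one_le_rpow (by norm_num) (by positivity)
  have h2 : (2 : ℝ) ≤ 2 ^ (1 / ε) := by
    calc (2 : ℝ) = 2 ^ (1 : ℝ) := by norm_num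
      _ ≤ _ := Real.rpow_le_rpow_of_exponent_le (by norm_num) hε
  calc m + 1 ≤ 2 ^ (18 / ε) * 2 := by linarith
    _ ≤ 2 ^ (18 / ε) * 2 ^ (1 / ε) := by gcongr
    _ = _ := by rw [← Real.rpow_add (by norm_num)]; congr 1; ring

/-- XOS functions are close in `ℓ₂` to juntas of low degree and low spectral norm. -/
theorem IsXOS.exists_junta_approx {f : (Fin n → Bool) → ℝ} (hf : IsXOS f)
    (h01 : ∀ x, f x ∈ Set.Icc (0 : ℝ) 1) {ε : ℝ} (h0 : 0 < ε) :
    ∃ (k : ℕ) (p : (Fin n → Bool) → ℝ), (k : ℝ) ≤ (2 : ℝ) ^ (57 / ε) ∧ IsJunta k p ∧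
      (fourierDegree p : ℝ) ≤ 57 / ε ∧ l2Norm (f - p) ≤ ε ∧
      spectralNorm1 p ≤ (2 : ℝ) ^ (57 / ε ^ 2) := by
  have hdeg : ∀ {a : ℝ}, a ≤ 57 → a / ε ≤ 57 / ε := fun h => div_le_div_of_nonneg_right h h0.le
  rcases le_or_gt 1 ε with h1 | h1
  -- For `ε ≥ 1` the zero function is already close enough.
  · have hz : ∀ S, fourierHat (0 : (Fin n → Bool) → ℝ) S = 0 := fun S => by simp [fourierHat]
    refine ⟨0, 0, by rw [Nat.cast_zero]; positivity, ⟨∅, by simp, fun x y _ => rfl⟩, ?_, ?_, ?_⟩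
    · have : fourierDegree (0 : (Fin n → Bool) → ℝ) = 0 := by simp [fourierDegree, hz]
      rw [this, Nat.cast_zero]; positivity
    · refine le_trans ?_ h1
      rw [sub_zero, l2Norm, Real.sqrt_le_one]
      exact Finset.expect_le Finset.univ_nonempty fun x _ =>
        pow_le_one₀ (h01 x).1 (h01 x).2
    · have : spectralNorm1 (0 : (Fin n → Bool) → ℝ) = 0 := by simp [spectralNorm1, hz]
      rw [this]; positivity
  obtain ⟨W, hW⟩ := hf.exists_weights fun x => (h01 x).2
  -- This `d` makes the high-level error at most `ε² / 4`, and `ρ` below makes the low-level error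
  -- `ε² / 2`. The constant `57 = 19 * 3` comes from the spectral norm bound `(J.card + 1) ^ d`.
  set d := ⌈2 / ε⌉₊ with hd
  have hd2 : 2 / ε ≤ d := Nat.le_ceil _
  have hd3 : (d : ℝ) ≤ 3 / ε := by
    have := Nat.ceil_lt_add_one (show 0 ≤ 2 / ε by positivity)
    have h2 : 1 ≤ 1 / ε := (one_le_div h0).2 h1.le
    have h3 : 3 / ε = 2 / ε + 1 / ε := by ring
    linarith
  set ρ := ε ^ 2 / (2 * 3 ^ d) with hρ
  have hρ0 : 0 ≤ ρ := by positivity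
  set J := influential f (ρ ^ 2) with hJ
  have hJc : (J.card : ℝ) + 1 ≤ 2 ^ (19 / ε) :=
    le_two_rpow_of_mul_le h0 h1 hd3 (hW.card_influential_mul_le hf.monotone (ρ ^ 2))
  have habs : ∀ x, |f x| ≤ 1 := fun x => by rw [abs_of_nonneg (h01 x).1]; exact (h01 x).2
  refine ⟨J.card, fourierSum (smallSubsets J d) (fourierHat f), ?_,
    ⟨J, le_rfl, dependsOn_fourierSum (fun S hS => (mem_smallSubsets.1 hS).1) _⟩, ?_, ?_, ?_⟩
  · have : (2 : ℝ) ^ (19 / ε) ≤ 2 ^ (57 / ε) :=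
      Real.rpow_le_rpow_of_exponent_le (by norm_num) (hdeg (by norm_num))
    linarith
  · refine le_trans ?_ (hd3.trans (hdeg (by norm_num)))
    exact Nat.cast_le.2 (fourierDegree_fourierSum_le (fun S hS => (mem_smallSubsets.1 hS).2) _)
  · refine Real.sqrt_le_iff.2 ⟨h0.le, (hW.expect_sq_sub_le hf.monotone d hρ0).trans ?_⟩
    have e1 : 3 ^ d * ρ = ε ^ 2 / 2 := by rw [hρ]; field_simp
    have e2 : 1 / ((d : ℝ) + 1) ^ 2 ≤ ε ^ 2 / 4 := by
      rw [div_le_iff₀ (by positivity)]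
      have : 2 ≤ ε * ((d : ℝ) + 1) := by
        rw [div_le_iff₀ h0] at hd2
        linarith
      nlinarith
    rw [e1]
    nlinarith [sq_nonneg ε]
  · refine (spectralNorm1_fourierSum_le habs _).trans ?_
    calc ((smallSubsets J d).card : ℝ) ≤ ((J.card : ℝ) + 1) ^ d := by
          exact_mod_cast card_smallSubsets_le J d
      _ ≤ ((2 : ℝ) ^ (19 / ε)) ^ d := by gcongr
      _ = 2 ^ (19 / ε * d) := by rw [Real.rpow_mul (by norm_num), Real.rpow_natCast]
      _ ≤ 2 ^ (57 / ε ^ 2) := by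
        refine Real.rpow_le_rpow_of_exponent_le (by norm_num) ?_
        calc 19 / ε * d ≤ 19 / ε * (3 / ε) := by gcongr
          _ = _ := by field_simp; norm_num

/-! ### The lower bound: the largest fraction of ones in a block. -/

variable {m b : ℕ}

/-- The `j`-th of `m` consecutive blocks of `b` bits. -/
def block (x : Fin (m * b) → Bool) (j : Fin m) : Fin b → Bool :=
  fun i => x (finProdFinEquiv (j, i))

/-- The index of the block that contains a coordinate. -/
def blockIndex (k : Fin (m * b)) : Fin m := (finProdFinEquiv.symm k).1

@[simp] lemma blockIndex_finProdFinEquiv (j : Fin m) (i : Fin b) :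
    blockIndex (finProdFinEquiv (j, i)) = j := by simp [blockIndex]

/-- The blocks as a function of the point of the cube. -/
def blockEquiv (m b : ℕ) : (Fin (m * b) → Bool) ≃ (Fin m → Fin b → Bool) where
  toFun := block
  invFun z k := z (finProdFinEquiv.symm k).1 (finProdFinEquiv.symm k).2
  left_inv x := by funext k; exact congrArg x (finProdFinEquiv.apply_symm_apply k)
  right_inv z := by funext j i; simp [block]

/-- The all-ones block. -/
def full (b : ℕ) : Fin b → Bool := fun _ => true

/-- The uniform weight vector on the `j`-th block. -/
noncomputable def blockWeight (m b : ℕ) (j : Fin m) (k : Fin (m * b)) : ℝ :=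
  if blockIndex k = j then 1 / b else 0

lemma sum_blockWeight_mul_bit (j : Fin m) (x : Fin (m * b) → Bool) :
    ∑ k, blockWeight m b j k * bit (x k) = ∑ i, 1 / (b : ℝ) * bit (block x j i) := by
  rw [← Equiv.sum_comp finProdFinEquiv, Fintype.sum_prod_type]
  simp only [blockWeight, blockIndex_finProdFinEquiv, ite_mul, zero_mul]
  rw [Finset.sum_eq_single j (fun j' _ hj' => by simp [hj']) (by simp)]
  simp [block]

lemma image_blockWeight_nonempty [NeZero m] :
    (univ.image (blockWeight m b)).Nonempty := Finset.univ_nonempty.image _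

/-- The largest fraction of ones in a block. -/
noncomputable def maxBlock (m b : ℕ) [NeZero m] (x : Fin (m * b) → Bool) : ℝ :=
  (univ.image (blockWeight m b)).sup' image_blockWeight_nonempty
    fun w => ∑ k, w k * bit (x k)

lemma isXOS_maxBlock [NeZero m] : IsXOS (maxBlock m b) := by
  refine ⟨_, image_blockWeight_nonempty, fun w hw k => ?_, fun x => rfl⟩
  obtain ⟨j, -, rfl⟩ := Finset.mem_image.1 hw
  unfold blockWeight
  split_ifs <;> positivity

lemma maxBlock_le_iff [NeZero m] {x : Fin (m * b) → Bool} {a : ℝ} :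
    maxBlock m b x ≤ a ↔ ∀ j, ∑ i, 1 / (b : ℝ) * bit (block x j i) ≤ a := by
  simp only [← sum_blockWeight_mul_bit]
  simp [maxBlock]

lemma le_maxBlock [NeZero m] (x : Fin (m * b) → Bool) (j : Fin m) :
    ∑ i, 1 / (b : ℝ) * bit (block x j i) ≤ maxBlock m b x := maxBlock_le_iff.1 le_rfl j

lemma bit_mem_Icc (c : Bool) : bit c ∈ Set.Icc (0 : ℝ) 1 := by cases c <;> simp [bit]

lemma maxBlock_mem_Icc [NeZero m] [NeZero b] (x : Fin (m * b) → Bool) :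
    maxBlock m b x ∈ Set.Icc (0 : ℝ) 1 := by
  have hb : (b : ℝ) ≠ 0 := Nat.cast_ne_zero.2 (NeZero.ne b)
  constructor
  · refine le_trans (Finset.sum_nonneg fun i _ => ?_) (le_maxBlock x 0)
    exact mul_nonneg (by positivity) (bit_mem_Icc _).1
  · refine maxBlock_le_iff.2 fun j => ?_
    calc _ ≤ ∑ _i : Fin b, 1 / (b : ℝ) := Finset.sum_le_sum fun i _ =>
          mul_le_of_le_one_right (by positivity) (bit_mem_Icc _).2
      _ = 1 := by simp [hb]

lemma maxBlock_eq_one [NeZero m] [NeZero b] {x : Fin (m * b) → Bool} {j : Fin m}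
    (h : block x j = full b) : maxBlock m b x = 1 := by
  have hb : (b : ℝ) ≠ 0 := Nat.cast_ne_zero.2 (NeZero.ne b)
  refine le_antisymm (maxBlock_mem_Icc x).2 (le_trans ?_ (le_maxBlock x j))
  simp [h, full, bit, hb]

lemma maxBlock_le_of_forall_ne_full [NeZero m] [NeZero b] {x : Fin (m * b) → Bool}
    (h : ∀ j, block x j ≠ full b) : maxBlock m b x ≤ 1 - 1 / b := by
  have hb : (b : ℝ) ≠ 0 := Nat.cast_ne_zero.2 (NeZero.ne b)
  refine maxBlock_le_iff.2 fun j => ?_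
  obtain ⟨i₀, hi₀⟩ := Function.ne_iff.1 (h j)
  have h0 : block x j i₀ = false := by simpa [full] using hi₀
  rw [← Finset.add_sum_erase _ _ (Finset.mem_univ i₀), h0]
  calc _ ≤ 1 / (b : ℝ) * bit false + ∑ _i ∈ univ.erase i₀, 1 / (b : ℝ) := by
        refine add_le_add le_rfl (Finset.sum_le_sum fun i _ => ?_)
        exact mul_le_of_le_one_right (by positivity) (bit_mem_Icc _).2
    _ = 1 - 1 / b := by
        have h1 : ∑ _i : Fin b, 1 / (b : ℝ) = 1 := by simp [hb]
        have h2 := Finset.add_sum_erase univ (fun _ : Fin b => 1 / (b : ℝ)) (Finset.mem_univ i₀)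
        simp only [bit]
        norm_num at h1 h2 ⊢
        linarith

/-- The indicator function of the event that no block with index in `U` is full. -/
def noFull (U : Finset (Fin m)) (x : Fin (m * b) → Bool) : ℝ :=
  if ∀ j ∈ U, block x j ≠ full b then 1 else 0

/-- The blocks are independent and each is full with probability `1 / 2 ^ b`. -/
lemma expect_noFull (U : Finset (Fin m)) :
    𝔼 x, noFull (b := b) U x = (1 - 1 / 2 ^ b) ^ U.card := by
  have hN : (2 : ℝ) ^ b ≠ 0 := by positivity
  have h1 : 𝔼 x, noFull (b := b) U x
      = 𝔼 z : Fin m → Fin b → Bool, ∏ j, if j ∈ U ∧ z j = full b then (0 : ℝ) else 1 := by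
    refine Fintype.expect_equiv (blockEquiv m b) _ _ fun x => ?_
    change _ = ∏ j, if j ∈ U ∧ block x j = full b then (0 : ℝ) else 1
    unfold noFull
    split_ifs with h
    · exact (Finset.prod_eq_one fun j _ => if_neg fun hj => h j hj.1 hj.2).symm
    · push Not at h
      obtain ⟨j, hj⟩ := h
      refine (Finset.prod_eq_zero (Finset.mem_univ j) ?_).symm
      exact if_pos hj
  have h2 : ∀ j, ∑ c : Fin b → Bool, (if j ∈ U ∧ c = full b then (0 : ℝ) else 1)
      = 2 ^ b * if j ∈ U then 1 - 1 / 2 ^ b else 1 := by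
    intro j
    by_cases hj : j ∈ U
    · have : ∀ c : Fin b → Bool, (if c = full b then (0 : ℝ) else 1)
          = 1 - if c = full b then 1 else 0 := fun c => by split_ifs <;> simp
      simp only [hj, true_and, if_true, this, Finset.sum_sub_distrib]
      simp
      field_simp
    · simp [hj]
  rw [h1, Fintype.expect_eq_sum_div_card, ← Fintype.piFinset_univ,
    ← Finset.prod_univ_sum (fun _ => univ) fun j c => if j ∈ U ∧ c = full b then (0 : ℝ) else 1]
  simp only [h2, Finset.prod_mul_distrib, Finset.prod_ite_mem, Finset.univ_inter,
    Finset.prod_const]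
  simp [Fintype.card_pi, hN]

/-- Exchanging the coordinates outside `T` between two independent uniform points preserves their
joint law. This allows conditioning on the coordinates in `T` while resampling the others. -/
lemma expect_piecewise {n : ℕ} (T : Finset (Fin n)) (φ : (Fin n → Bool) → ℝ) :
    𝔼 x, 𝔼 y, φ (T.piecewise x y) = 𝔼 x, φ x := by
  let e : (Fin n → Bool) × (Fin n → Bool) ≃ (Fin n → Bool) × (Fin n → Bool) :=
    { toFun := fun q => (T.piecewise q.1 q.2, T.piecewise q.2 q.1)
      invFun := fun q => (T.piecewise q.1 q.2, T.piecewise q.2 q.1)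
      left_inv := fun q => by
        ext k <;> by_cases hk : k ∈ T <;> simp [hk]
      right_inv := fun q => by
        ext k <;> by_cases hk : k ∈ T <;> simp [hk] }
  calc 𝔼 x, 𝔼 y, φ (T.piecewise x y)
      = 𝔼 q : (Fin n → Bool) × (Fin n → Bool), φ (T.piecewise q.1 q.2) := by
        rw [← Finset.univ_product_univ, Finset.expect_product]
    _ = 𝔼 q : (Fin n → Bool) × (Fin n → Bool), φ q.1 := Fintype.expect_equiv e _ _ fun _ => rfl
    _ = 𝔼 x, φ x := by
        rw [← Finset.univ_product_univ, Finset.expect_product]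
        simp

/-- The coordinates in the blocks with index in `A`. -/
def blockCoords (b : ℕ) (A : Finset (Fin m)) : Finset (Fin (m * b)) :=
  univ.filter fun k => blockIndex k ∈ A

lemma block_piecewise (A : Finset (Fin m)) (x y : Fin (m * b) → Bool) (j : Fin m) :
    block ((blockCoords b A).piecewise x y) j = if j ∈ A then block x j else block y j := by
  funext i
  by_cases hj : j ∈ A <;> simp [block, Finset.piecewise, blockCoords, hj]

/-- A function of few coordinates is far from `maxBlock`. -/
lemma le_expect_sq_maxBlock_sub [NeZero m] [NeZero b] {g : (Fin (m * b) → Bool) → ℝ}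
    {A : Finset (Fin m)} (hg : DependsOn g (blockCoords b A : Set (Fin (m * b))))
    (hA : 1 / 2 ≤ 𝔼 x, noFull (b := b) A x)
    (hU : 1 / 5 ≤ 𝔼 x, noFull (b := b) Aᶜ x) (hU' : 𝔼 x, noFull (b := b) Aᶜ x ≤ 4 / 5) :
    1 / (40 * (b : ℝ) ^ 2) ≤ 𝔼 x, (maxBlock m b - g) x ^ 2 := by
  have hb : (0 : ℝ) < b := Nat.cast_pos.2 (Nat.pos_of_ne_zero (NeZero.ne b))
  set δ : ℝ := 1 / (2 * b) with hδ
  have hδ0 : 0 < δ := by positivity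
  have hbδ : 1 / (b : ℝ) = 2 * δ := by rw [hδ]; field_simp
  have hgx : ∀ x y, g ((blockCoords b A).piecewise x y) = g x := fun x y =>
    hg fun k hk => Finset.piecewise_eq_of_mem _ _ _ hk
  have key : ∀ x, noFull A x * (1 / 5 * δ ^ 2)
      ≤ 𝔼 y, (maxBlock m b - g) ((blockCoords b A).piecewise x y) ^ 2 := by
    intro x
    simp only [Pi.sub_apply, hgx]
    by_cases hx : ∀ j ∈ A, block x j ≠ full b
    swap
    · rw [noFull, if_neg hx, zero_mul]
      exact Finset.expect_nonneg fun y _ => sq_nonneg _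
    rw [noFull, if_pos hx, one_mul]
    -- The value `1 - δ` is midway between `1 - 1 / b` and `1`. Whichever side `g x` lies on, the
    -- unseen blocks put `maxBlock` at distance at least `δ` from it with probability at least `1 /
    -- 5`.
    rcases le_or_gt (1 - δ) (g x) with hs | hs
    · calc 1 / 5 * δ ^ 2 ≤ (𝔼 y, noFull (b := b) Aᶜ y) * δ ^ 2 := by gcongr
        _ = 𝔼 y, noFull (b := b) Aᶜ y * δ ^ 2 := Finset.expect_mul _ _ _
        _ ≤ _ := Finset.expect_le_expect fun y _ => by
          unfold noFull
          split_ifs with hy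
          · have : maxBlock m b ((blockCoords b A).piecewise x y) ≤ 1 - 1 / b := by
              refine maxBlock_le_of_forall_ne_full fun j => ?_
              rw [block_piecewise]
              split_ifs with hj
              · exact hx j hj
              · exact hy j (Finset.mem_compl.2 hj)
            rw [hbδ] at this
            nlinarith
          · rw [zero_mul]; exact sq_nonneg _
    · calc 1 / 5 * δ ^ 2 ≤ (𝔼 y, (1 - noFull (b := b) Aᶜ y)) * δ ^ 2 := by
            rw [Finset.expect_sub_distrib, Fintype.expect_const]
            gcongr
            linarith
        _ = 𝔼 y, (1 - noFull (b := b) Aᶜ y) * δ ^ 2 := Finset.expect_mul _ _ _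
        _ ≤ _ := Finset.expect_le_expect fun y _ => by
          unfold noFull
          split_ifs with hy
          · rw [sub_self, zero_mul]; exact sq_nonneg _
          · push Not at hy
            obtain ⟨j, hj, hjf⟩ := hy
            have : maxBlock m b ((blockCoords b A).piecewise x y) = 1 := by
              refine maxBlock_eq_one (j := j) ?_
              rw [block_piecewise, if_neg (Finset.mem_compl.1 hj), hjf]
            rw [this]
            nlinarith
  rw [← expect_piecewise (blockCoords b A)]
  calc 1 / (40 * (b : ℝ) ^ 2) = 1 / 2 * (1 / 5 * δ ^ 2) := by rw [hδ]; field_simp; norm_num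
    _ ≤ (𝔼 x, noFull (b := b) A x) * (1 / 5 * δ ^ 2) := by gcongr
    _ = 𝔼 x, noFull (b := b) A x * (1 / 5 * δ ^ 2) := Finset.expect_mul _ _ _
    _ ≤ _ := Finset.expect_le_expect fun x _ => key x

lemma half_le_one_sub_pow {N : ℝ} (hN : 1 ≤ N) {a : ℕ} (ha : 2 * (a : ℝ) ≤ N) :
    1 / 2 ≤ (1 - 1 / N) ^ a := by
  have h := one_add_mul_le_pow (a := -(1 / N)) (by
    have : 1 / N ≤ 1 := by rw [div_le_one (by linarith)]; exact hN
    linarith) a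
  have h2 : (a : ℝ) * (1 / N) ≤ 1 / 2 := by
    rw [mul_one_div, div_le_iff₀ (by linarith)]; linarith
  rw [← sub_eq_add_neg] at h
  linarith

/-- Bernoulli gives `(1 + 1 / N) ^ a ≥ 5 / 4`, and its product with `(1 - 1 / N) ^ a` is at most
`1`. -/
lemma one_sub_pow_le {N : ℝ} (hN : 1 ≤ N) {a : ℕ} (ha : N ≤ 4 * (a : ℝ)) :
    (1 - 1 / N) ^ a ≤ 4 / 5 := by
  have hN0 : 0 < N := by linarith
  have hx1 : 1 / N ≤ 1 := by rw [div_le_one hN0]; exact hN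
  have hx0 : 0 < 1 / N := by positivity
  have h := one_add_mul_le_pow (a := 1 / N) (by linarith) a
  have h2 : 1 / 4 ≤ (a : ℝ) * (1 / N) := by
    rw [mul_one_div, le_div_iff₀ hN0]; linarith
  have h3 : (1 - 1 / N) ^ a * (1 + 1 / N) ^ a ≤ 1 := by
    rw [← mul_pow]
    refine pow_le_one₀ (mul_nonneg (by linarith) (by linarith)) ?_
    nlinarith
  have h4 : 0 ≤ (1 - 1 / N) ^ a := pow_nonneg (by linarith) a
  nlinarith

/-- Juntas that approximate `maxBlock` depend on exponentially many coordinates. -/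
lemma two_pow_le_of_isJunta (b : ℕ) {k : ℕ} {g : (Fin (2 ^ b * (b + 1)) → Bool) → ℝ}
    (hg : IsJunta k g) {ε : ℝ} (hε : 7 * ((b : ℝ) + 1) * ε ≤ 1)
    (hfg : l2Norm (maxBlock (2 ^ b) (b + 1) - g) ≤ ε) : 2 ^ b ≤ 2 * k := by
  by_contra! hk
  obtain ⟨J, hJk, hJ⟩ := hg
  -- The blocks touched by the junta: fewer than half of all `2 ^ b`, so the untouched ones number
  -- more than `2 ^ (b + 1) / 4`.
  set A := J.image blockIndex with hA
  have hAk : A.card ≤ k := Finset.card_image_le.trans hJk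
  have hAU : A.card + Aᶜ.card = 2 ^ b := by
    rw [Finset.card_add_card_compl, Fintype.card_fin]
  have hN : ((2 ^ (b + 1) : ℕ) : ℝ) = 2 ^ (b + 1) := by push_cast; rfl
  have hN1 : (1 : ℝ) ≤ 2 ^ (b + 1) := one_le_pow₀ (by norm_num)
  have hgA : DependsOn g (blockCoords (b + 1) A : Set (Fin (2 ^ b * (b + 1)))) := by
    refine fun x y hxy => hJ fun i hi => hxy i ?_
    simp only [blockCoords, Finset.coe_filter, Finset.mem_univ, true_and, Set.mem_ofPred_eq]
    exact Finset.mem_image_of_mem _ hi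
  have h1 : 1 / 2 ≤ 𝔼 x, noFull (b := b + 1) A x := by
    rw [expect_noFull]
    refine half_le_one_sub_pow hN1 ?_
    rw [← hN]
    exact_mod_cast (by omega : 2 * A.card ≤ 2 ^ (b + 1))
  have h2 : 1 / 5 ≤ 𝔼 x, noFull (b := b + 1) Aᶜ x := by
    rw [expect_noFull]
    refine le_trans (by norm_num) (half_le_one_sub_pow hN1 ?_)
    rw [← hN]
    exact_mod_cast (by omega : 2 * Aᶜ.card ≤ 2 ^ (b + 1))
  have h3 : 𝔼 x, noFull (b := b + 1) Aᶜ x ≤ 4 / 5 := by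
    rw [expect_noFull]
    refine one_sub_pow_le hN1 ?_
    rw [← hN]
    exact_mod_cast (by omega : 2 ^ (b + 1) ≤ 4 * Aᶜ.card)
  have h := le_expect_sq_maxBlock_sub hgA h1 h2 h3
  have hε0 : 0 ≤ ε := (Real.sqrt_nonneg _).trans hfg
  have hsq := h.trans (Real.sqrt_le_iff.1 hfg).2
  push_cast at hsq
  rw [div_le_iff₀ (by positivity)] at hsq
  -- The contradiction rests on `7 ^ 2 > 40`.
  have h5 : (7 * ((b : ℝ) + 1) * ε) ^ 2 ≤ 1 := pow_le_one₀ (by positivity) hε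
  nlinarith

/-- The junta size needed for the approximation of XOS functions is exponential in `1 / ε`. -/
theorem exists_isXOS_forall_junta_le {ε : ℝ} (h0 : 0 < ε) (h1 : ε ≤ 1 / 56) :
    ∃ (n : ℕ) (f : (Fin n → Bool) → ℝ), IsXOS f ∧ (∀ x, f x ∈ Set.Icc (0 : ℝ) 1) ∧
      ∀ (k : ℕ) (g : (Fin n → Bool) → ℝ), IsJunta k g → l2Norm (f - g) ≤ ε →
        (2 : ℝ) ^ (1 / 14 / ε) ≤ (k : ℝ) := by
  have h8 : 8 ≤ 1 / (7 * ε) := by rw [le_div_iff₀ (by positivity)]; linarith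
  set b := ⌊1 / (7 * ε)⌋₊ - 1 with hb
  have hfl : 8 ≤ ⌊1 / (7 * ε)⌋₊ := Nat.le_floor (by exact_mod_cast h8)
  have hb1 : ((b : ℝ) + 1) = ⌊1 / (7 * ε)⌋₊ := by
    rw [hb, Nat.cast_sub (by omega)]; push_cast; ring
  have hle : ((b : ℝ) + 1) ≤ 1 / (7 * ε) := hb1 ▸ Nat.floor_le (by positivity)
  have hlt : 1 / (7 * ε) < (b : ℝ) + 1 + 1 := hb1 ▸ Nat.lt_floor_add_one _
  refine ⟨2 ^ b * (b + 1), maxBlock (2 ^ b) (b + 1), isXOS_maxBlock, maxBlock_mem_Icc,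
    fun k g hg hfg => ?_⟩
  have hk := two_pow_le_of_isJunta b hg (by
    rw [le_div_iff₀ (by positivity)] at hle
    linarith) hfg
  have hk' : (2 : ℝ) ^ b ≤ 2 * k := by exact_mod_cast hk
  -- Since `b > 1 / (7 * ε) - 2` and `1 / (7 * ε) ≥ 8`, half of `1 / (7 * ε)` fits with room for the
  -- extra `1`, which pays for the factor `2` in `2 ^ b ≤ 2 * k`.
  have hexp : 1 / 14 / ε + 1 ≤ (b : ℝ) := by
    have e : 1 / 14 / ε = 1 / (7 * ε) / 2 := by field_simp; norm_num
    rw [e]; linarith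
  have : (2 : ℝ) ^ (1 / 14 / ε) * 2 ≤ 2 ^ b := by
    rw [← Real.rpow_natCast]
    calc (2 : ℝ) ^ (1 / 14 / ε) * 2 = 2 ^ (1 / 14 / ε + 1) := by
          rw [Real.rpow_add (by norm_num), Real.rpow_one]
      _ ≤ _ := Real.rpow_le_rpow_of_exponent_le (by norm_num) hexp
  linarith

end BoolCube

theorem mainTheorem8 :
    (∃ K : ℝ, 0 < K ∧
      ∀ (n : ℕ) (f : (Fin n → Bool) → ℝ), BoolCube.IsXOS f → (∀ x, f x ∈ Set.Icc (0 : ℝ) 1) →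
        ∀ ε : ℝ, 0 < ε →
          ∃ (k : ℕ) (p : (Fin n → Bool) → ℝ),
            (k : ℝ) ≤ (2 : ℝ) ^ (K / ε) ∧
            BoolCube.IsJunta k p ∧
            (BoolCube.fourierDegree p : ℝ) ≤ K / ε ∧
            BoolCube.l2Norm (f - p) ≤ ε ∧
            BoolCube.spectralNorm1 p ≤ (2 : ℝ) ^ (K / ε ^ 2)) ∧
    (∃ c ε₀ : ℝ, 0 < c ∧ 0 < ε₀ ∧
      ∀ ε : ℝ, 0 < ε → ε ≤ ε₀ →
        ∃ (n : ℕ) (f : (Fin n → Bool) → ℝ), BoolCube.IsXOS f ∧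
          (∀ x, f x ∈ Set.Icc (0 : ℝ) 1) ∧
          ∀ (k : ℕ) (g : (Fin n → Bool) → ℝ), BoolCube.IsJunta k g →
            BoolCube.l2Norm (f - g) ≤ ε → (2 : ℝ) ^ (c / ε) ≤ (k : ℝ)) :=
  ⟨⟨57, by norm_num, fun _ _ hf h01 _ h0 => hf.exists_junta_approx h01 h0⟩,
    1 / 14, 1 / 56, by norm_num, by norm_num,
    fun _ h0 h1 => BoolCube.exists_isXOS_forall_junta_le h0 h1⟩
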